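/- An involution on a (not necessarily unital) ring $R$ is an additive map $x\mapsto x^*$ with $(xy)^*=y^*x^*$ and $(x^*)^*=x$. It is *positive definite* if for every positive integer $n$ and all $x_1,\dots,x_n\in R$, $x_1^*x_1+\dots+x_n^*x_n=0$ implies $x_1=\dots=x_n=0$. A projection is an element $p\in R$ with $p=p^*=p^2$, and $R$ is *$*$-regular* if every principal right ideal is generated by a projection: for every $a\in R$ there is a projection $p\in R$ with $aR=pR$. A (directed) graph $E=(E^0,E^1,r,s)$ consists of a set $E^0$ of vertices and a set $E^1$ of edges, of arbitrary cardinalities, and maps $r,s:E^1\to E^0$. A cycle in $E$ is a sequence of edges $e_1\cdots e_n$, $n\ge 1$, with $r(e_i)=s(e_{i+1})$ for $1\le i<n$, $r(e_n)=s(e_1)$, and $s(e_i)\ne s(e_j)$ for $i\neq j$; $E$ is *acyclic* if it contains no cycles. For a field $K$, the Leavitt path algebra $L_K(E)$ is the (associative, not necessarily unital) $K$-algebra generated by the set $E^0\cup E^1\cup\{e^*\mid e\in E^1\}$ subject to the relations (V) $vw=\delta_{v,w}v$ for all $v,w\in E^0$; (P1) $s(e)e=er(e)=e$ for all $e\in E^1$;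 (P2) $r(e)e^*=e^*s(e)=e^*$ for all $e\in E^1$; (CK1) $e^*f=\delta_{e,f}r(e)$ for all $e,f\in E^1$; (CK2) $v=\sum_{e\in s^{-1}(v)}ee^*$ for every $v\in E^0$ for which $s^{-1}(v)$ is finite and nonempty. If $K$ carries an involution $k\mapsto\overline{k}$, then $L_K(E)$ carries the induced involution: the one that satisfies $(kx)^*=\overline{k}x^*$ for $k\in K$, $x\in L_K(E)$, fixes every vertex, and exchanges $e$ and $e^*$ for every edge $e$. **Corollary 3.4.** Let $K$ be a field with an involution. The following conditions are equivalent: (i) the involution on $K$ is positive definite; (ii) for every acyclic graph $E$, the Leavitt path algebra $L_K(E)$, with the induced involution, is $*$-regular. -/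

import Mathlib

universe u v w

/-- A (directed) graph `E = (E⁰, E¹, r, s)`: two sets of arbitrary cardinality with two maps. -/
structure DirectedGraph where
  /-- the set `E⁰` of vertices -/
  Vertex : Type u
  /-- the set `E¹` of edges -/
  Edge : Type v
  /-- the source map -/
  s : Edge → Vertex
  /-- the range map -/
  r : Edge → Vertex

namespace DirectedGraph

/-- A cycle: a path `e₁ … eₙ` of length `n ≥ 1`, so `r(eᵢ) = s(eᵢ₊₁)`, which is closed,
`s(e₁) = r(eₙ)`, and whose edges have pairwise distinct sources. -/
def IsCycle (E : DirectedGraph.{u, v}) (p : List E.Edge) : Prop :=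
  p.IsChain (fun e f => E.r e = E.s f) ∧
    (∃ h : p ≠ [], E.s (p.head h) = E.r (p.getLast h)) ∧
    (p.map E.s).Nodup

/-- A graph is acyclic if it contains no cycles. -/
def Acyclic (E : DirectedGraph.{u, v}) : Prop :=
  ∀ p : List E.Edge, ¬ E.IsCycle p

end DirectedGraph

/-- The generators `E⁰ ∪ E¹ ∪ {e* ∣ e ∈ E¹}` (a disjoint union) of the Leavitt path algebra. -/
inductive LeavittGen (E : DirectedGraph.{u, v}) : Type (max u v)
  | vertex (v : E.Vertex) : LeavittGen E
  | edge (e : E.Edge) : LeavittGen E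
  | ghost (e : E.Edge) : LeavittGen E

/-- The adjoint of a generator: `v* = v`, `(e)* = e*`, `(e*)* = e`. -/
def LeavittGen.adj {E : DirectedGraph.{u, v}} : LeavittGen E → LeavittGen E
  | .vertex v => .vertex v
  | .edge e => .ghost e
  | .ghost e => .edge e

/-- The free (associative, not necessarily unital) `K`-algebra on the generators: the semigroup
algebra of the free semigroup of nonempty words. -/
abbrev FreeLeavitt (K : Type w) [Field K] (E : DirectedGraph.{u, v}) : Type (max u v w) :=
  MonoidAlgebra K (FreeSemigroup (LeavittGen E))

namespace FreeLeavitt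

variable (K : Type w) [Field K] (E : DirectedGraph.{u, v})

/-- A generator as an element of the free algebra. -/
noncomputable def gen (g : LeavittGen E) : FreeLeavitt K E :=
  MonoidAlgebra.single (FreeSemigroup.of g) 1

/-- The defining relations of the Leavitt path algebra. -/
inductive Rel : FreeLeavitt K E → FreeLeavitt K E → Prop
  /-- (V), equal vertices -/
  | vertex_mul_self (v : E.Vertex) :
      Rel (gen K E (.vertex v) * gen K E (.vertex v)) (gen K E (.vertex v))
  /-- (V), distinct vertices -/
  | vertex_mul_of_ne (v w : E.Vertex) (h : v ≠ w) :
      Rel (gen K E (.vertex v) * gen K E (.vertex w)) 0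
  /-- (P1), source -/
  | source_mul_edge (e : E.Edge) :
      Rel (gen K E (.vertex (E.s e)) * gen K E (.edge e)) (gen K E (.edge e))
  /-- (P1), range -/
  | edge_mul_range (e : E.Edge) :
      Rel (gen K E (.edge e) * gen K E (.vertex (E.r e))) (gen K E (.edge e))
  /-- (P2), range -/
  | range_mul_ghost (e : E.Edge) :
      Rel (gen K E (.vertex (E.r e)) * gen K E (.ghost e)) (gen K E (.ghost e))
  /-- (P2), source -/
  | ghost_mul_source (e : E.Edge) :
      Rel (gen K E (.ghost e) * gen K E (.vertex (E.s e))) (gen K E (.ghost e))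
  /-- (CK1), equal edges -/
  | ghost_mul_edge_self (e : E.Edge) :
      Rel (gen K E (.ghost e) * gen K E (.edge e)) (gen K E (.vertex (E.r e)))
  /-- (CK1), distinct edges -/
  | ghost_mul_edge_of_ne (e f : E.Edge) (h : e ≠ f) :
      Rel (gen K E (.ghost e) * gen K E (.edge f)) 0
  /-- (CK2), for every vertex that is neither a sink nor an infinite emitter -/
  | vertex_eq_sum (v : E.Vertex) (hfin : {e : E.Edge | E.s e = v}.Finite)
      (hne : {e : E.Edge | E.s e = v}.Nonempty) :
      Rel (gen K E (.vertex v)) (∑ e ∈ hfin.toFinset, gen K E (.edge e) * gen K E (.ghost e))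

/-- The congruence of `K`-algebras generated by the defining relations. Scalar multiples of the
relations are imposed too, as a ring congruence of a ring without identity need not be
compatible with scalars. -/
noncomputable def con : RingCon (FreeLeavitt K E) :=
  ringConGen fun x y => ∃ (k : K) (a b : FreeLeavitt K E), Rel K E a b ∧ x = k • a ∧ y = k • b

variable {K E}

theorem con_of_rel {a b : FreeLeavitt K E} (h : Rel K E a b) : con K E a b :=
  RingConGen.Rel.of _ _ ⟨1, a, b, h, (one_smul _ _).symm, (one_smul _ _).symm⟩

theorem con_smul (k : K) {x y : FreeLeavitt K E} (h : con K E x y) :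
    con K E (k • x) (k • y) := by
  change RingConGen.Rel _ x y at h
  change RingConGen.Rel _ _ _
  induction h with
  | of x y h =>
    obtain ⟨k', a, b, h, rfl, rfl⟩ := h
    exact .of _ _ ⟨k * k', a, b, h, smul_smul _ _ _, smul_smul _ _ _⟩
  | refl x => exact .refl _
  | symm _ ih => exact ih.symm
  | trans _ _ ih₁ ih₂ => exact ih₁.trans ih₂
  | add _ _ ih₁ ih₂ => simpa only [smul_add] using ih₁.add ih₂
  | mul _ h₂ ih₁ _ => simpa only [smul_mul_assoc] using ih₁.mul h₂

/-- The adjoint of a word: `(g₁ g₂ … gₙ)* = gₙ* … g₂* g₁*`. -/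
def wordAdj (x : FreeSemigroup (LeavittGen E)) : FreeSemigroup (LeavittGen E) :=
  (FreeSemigroup.lift (fun g : LeavittGen E => MulOpposite.op (FreeSemigroup.of g.adj)) x).unop

theorem wordAdj_of (g : LeavittGen E) :
    wordAdj (FreeSemigroup.of g) = FreeSemigroup.of g.adj := rfl

theorem wordAdj_mul (x y : FreeSemigroup (LeavittGen E)) :
    wordAdj (x * y) = wordAdj y * wordAdj x := by
  simp [wordAdj]

theorem wordAdj_wordAdj (x : FreeSemigroup (LeavittGen E)) : wordAdj (wordAdj x) = x := by
  induction x using FreeSemigroup.recOnMul with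
  | ih1 g => cases g <;> rfl
  | ih2 g y ih₁ ih₂ => rw [wordAdj_mul, wordAdj_mul, ih₁, ih₂]

variable [StarRing K]

/-- The conjugate-linear map of the free algebra that sends each word to its adjoint. -/
noncomputable def adj : FreeLeavitt K E →+ FreeLeavitt K E :=
  (Finsupp.liftAddHom fun x : FreeSemigroup (LeavittGen E) =>
    (MonoidAlgebra.singleAddHom (wordAdj x)).comp
      (starAddEquiv : K ≃+ K).toAddMonoidHom).comp
    (MonoidAlgebra.coeffAddEquiv (R := K) (M := FreeSemigroup (LeavittGen E))).toAddMonoidHom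

theorem adj_single (x : FreeSemigroup (LeavittGen E)) (k : K) :
    adj (MonoidAlgebra.single x k : FreeLeavitt K E) =
      MonoidAlgebra.single (wordAdj x) (star k) := by
  simp [adj]

theorem adj_gen (g : LeavittGen E) : adj (gen K E g) = gen K E g.adj := by
  simp [gen, adj_single, wordAdj_of]

theorem adj_adj (x : FreeLeavitt K E) : adj (adj x) = x := by
  have : (adj.comp adj : FreeLeavitt K E →+ FreeLeavitt K E) = AddMonoidHom.id _ :=
    MonoidAlgebra.addMonoidHom_ext fun w k => by
      simp [adj_single, wordAdj_wordAdj]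
  exact DFunLike.congr_fun this x

theorem adj_mul (x y : FreeLeavitt K E) : adj (x * y) = adj y * adj x := by
  have : (adj.comp (AddMonoidHom.mulLeft x)) = (AddMonoidHom.mulRight (adj x)).comp adj := by
    refine MonoidAlgebra.addMonoidHom_ext fun w k => ?_
    have : (adj.comp (AddMonoidHom.mulRight (MonoidAlgebra.single w k : FreeLeavitt K E))) =
        (AddMonoidHom.mulLeft (adj (MonoidAlgebra.single w k : FreeLeavitt K E))).comp adj :=
      MonoidAlgebra.addMonoidHom_ext fun w' k' => by
        simp [adj_single, wordAdj_mul, MonoidAlgebra.single_mul_single, mul_comm]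
    exact DFunLike.congr_fun this x
  exact DFunLike.congr_fun this y

theorem adj_smul (k : K) (x : FreeLeavitt K E) : adj (k • x) = star k • adj x := by
  have : (adj.comp (DistribSMul.toAddMonoidHom _ k) : FreeLeavitt K E →+ FreeLeavitt K E) =
      (DistribSMul.toAddMonoidHom _ (star k)).comp adj :=
    MonoidAlgebra.addMonoidHom_ext fun w k => by
      simp [adj_single]
  exact DFunLike.congr_fun this x

theorem con_adj_of_rel {a b : FreeLeavitt K E} (h : Rel K E a b) : con K E (adj a) (adj b) := by
  cases h with
  | vertex_mul_self v =>
    simpa only [adj_mul, adj_gen, LeavittGen.adj] using con_of_rel (.vertex_mul_self v)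
  | vertex_mul_of_ne v w h =>
    simpa only [adj_mul, adj_gen, LeavittGen.adj, map_zero] using con_of_rel (.vertex_mul_of_ne w v h.symm)
  | source_mul_edge e =>
    simpa only [adj_mul, adj_gen, LeavittGen.adj] using con_of_rel (.ghost_mul_source e)
  | edge_mul_range e =>
    simpa only [adj_mul, adj_gen, LeavittGen.adj] using con_of_rel (.range_mul_ghost e)
  | range_mul_ghost e =>
    simpa only [adj_mul, adj_gen, LeavittGen.adj] using con_of_rel (.edge_mul_range e)
  | ghost_mul_source e =>
    simpa only [adj_mul, adj_gen, LeavittGen.adj] using con_of_rel (.source_mul_edge e)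
  | ghost_mul_edge_self e =>
    simpa only [adj_mul, adj_gen, LeavittGen.adj] using con_of_rel (.ghost_mul_edge_self e)
  | ghost_mul_edge_of_ne e f h =>
    simpa only [adj_mul, adj_gen, LeavittGen.adj, map_zero] using con_of_rel (.ghost_mul_edge_of_ne f e h.symm)
  | vertex_eq_sum v hfin hne =>
    simpa only [adj_mul, adj_gen, LeavittGen.adj, map_sum] using con_of_rel (.vertex_eq_sum v hfin hne)

theorem con_adj {x y : FreeLeavitt K E} (h : con K E x y) : con K E (adj x) (adj y) := by
  change RingConGen.Rel _ x y at h
  induction h with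
  | of x y h =>
    obtain ⟨k, a, b, h, rfl, rfl⟩ := h
    rw [adj_smul, adj_smul]
    exact con_smul _ (con_adj_of_rel h)
  | refl x => exact (con K E).refl _
  | symm _ ih => exact (con K E).symm ih
  | trans _ _ ih₁ ih₂ => exact (con K E).trans ih₁ ih₂
  | add _ _ ih₁ ih₂ => simpa only [map_add] using (con K E).add ih₁ ih₂
  | mul _ _ ih₁ ih₂ => simpa only [adj_mul] using (con K E).mul ih₂ ih₁

end FreeLeavitt

/-- The Leavitt path algebra `L_K(E)`: the (not necessarily unital) `K`-algebra generated by
`E⁰ ∪ E¹ ∪ {e* ∣ e ∈ E¹}` subject to (V), (P1), (P2), (CK1), (CK2). -/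
def LeavittPathAlgebra (K : Type w) [Field K] (E : DirectedGraph.{u, v}) : Type (max u v w) :=
  (FreeLeavitt.con K E).Quotient

namespace LeavittPathAlgebra

variable {K : Type w} [Field K] {E : DirectedGraph.{u, v}}

noncomputable instance : NonUnitalRing (LeavittPathAlgebra K E) :=
  inferInstanceAs (NonUnitalRing (FreeLeavitt.con K E).Quotient)

/-- The quotient map from the free algebra. -/
noncomputable def mk (x : FreeLeavitt K E) : LeavittPathAlgebra K E := RingCon.toQuotient x

theorem mk_surjective : Function.Surjective (mk : FreeLeavitt K E → LeavittPathAlgebra K E) :=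
  Quotient.mk''_surjective

theorem mk_eq_mk {x y : FreeLeavitt K E} : mk x = mk y ↔ FreeLeavitt.con K E x y :=
  RingCon.eq _

theorem mk_zero : (mk 0 : LeavittPathAlgebra K E) = 0 := rfl

theorem mk_add (x y : FreeLeavitt K E) : mk (x + y) = mk x + mk y := rfl

theorem mk_mul (x y : FreeLeavitt K E) : mk (x * y) = mk x * mk y := rfl

noncomputable instance : SMul K (LeavittPathAlgebra K E) where
  smul k := Quotient.map' (k • ·) fun _ _ h => FreeLeavitt.con_smul k h

theorem mk_smul (k : K) (x : FreeLeavitt K E) : mk (k • x) = k • mk x := rfl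

noncomputable instance : Module K (LeavittPathAlgebra K E) :=
  Function.Surjective.module K (⟨⟨mk, mk_zero⟩, mk_add⟩ : FreeLeavitt K E →+ _)
    mk_surjective mk_smul

instance : IsScalarTower K (LeavittPathAlgebra K E) (LeavittPathAlgebra K E) where
  smul_assoc k x y := by
    obtain ⟨x, rfl⟩ := mk_surjective x
    obtain ⟨y, rfl⟩ := mk_surjective y
    simp only [smul_eq_mul, ← mk_smul, ← mk_mul, smul_mul_assoc]

instance : SMulCommClass K (LeavittPathAlgebra K E) (LeavittPathAlgebra K E) where
  smul_comm k x y := by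
    obtain ⟨x, rfl⟩ := mk_surjective x
    obtain ⟨y, rfl⟩ := mk_surjective y
    simp only [smul_eq_mul, ← mk_smul, ← mk_mul, mul_smul_comm]

/-- The image in `L_K(E)` of a generator. -/
noncomputable def gen (K : Type w) [Field K] {E : DirectedGraph.{u, v}} (g : LeavittGen E) :
    LeavittPathAlgebra K E :=
  mk (FreeLeavitt.gen K E g)

variable [StarRing K]

/-- The involution of `L_K(E)` induced by the involution of `K`: the conjugate-linear
anti-multiplicative map that fixes the vertices and exchanges `e` and `e*`; hence it sends
`∑ kᵢ pᵢ qᵢ*` to `∑ star kᵢ • qᵢ pᵢ*`. -/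
noncomputable instance : StarRing (LeavittPathAlgebra K E) where
  star := Quotient.map' FreeLeavitt.adj fun _ _ h => FreeLeavitt.con_adj h
  star_involutive x := by
    obtain ⟨x, rfl⟩ := mk_surjective x
    exact congrArg mk (FreeLeavitt.adj_adj x)
  star_mul x y := by
    obtain ⟨x, rfl⟩ := mk_surjective x
    obtain ⟨y, rfl⟩ := mk_surjective y
    exact congrArg mk (FreeLeavitt.adj_mul x y)
  star_add x y := by
    obtain ⟨x, rfl⟩ := mk_surjective x
    obtain ⟨y, rfl⟩ := mk_surjective y
    exact congrArg mk (map_add FreeLeavitt.adj x y)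

theorem star_mk (x : FreeLeavitt K E) : star (mk x) = mk (FreeLeavitt.adj x) := rfl

theorem star_gen (g : LeavittGen E) : star (gen K g) = gen K g.adj :=
  congrArg mk (FreeLeavitt.adj_gen g)

instance : StarModule K (LeavittPathAlgebra K E) where
  star_smul k x := by
    obtain ⟨x, rfl⟩ := mk_surjective x
    exact congrArg mk (FreeLeavitt.adj_smul k x)

end LeavittPathAlgebra

/-- The involution of a `*`-ring is `n`-proper: `x₁* x₁ + ⋯ + xₙ* xₙ = 0` only if
`x₁ = ⋯ = xₙ = 0`. -/
def IsNProper (R : Type w) [NonUnitalRing R] [StarRing R] (n : ℕ) : Prop :=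
  ∀ x : Fin n → R, ∑ i, star (x i) * x i = 0 → ∀ i, x i = 0

/-- The involution of a `*`-ring is positive definite: `n`-proper for every positive `n`. -/
def IsPosDefInvolution (R : Type w) [NonUnitalRing R] [StarRing R] : Prop :=
  ∀ n : ℕ, 0 < n → IsNProper R n

/-- A `*`-ring (with local units) is `*`-regular: every principal right ideal `aR` is generated
by a projection, `aR = pR` with `p = p* = p²`. -/
def IsStarRegular (R : Type w) [NonUnitalRing R] [StarRing R] : Prop :=
  ∀ a : R, ∃ p : R, IsStarProjection p ∧
    Set.range (fun x : R => a * x) = Set.range (fun x : R => p * x)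

/-! ### Proper involution and local finiteness imply `*`-regularity. -/

section StarRegular

/-! For (i) ⇒ (ii), two properties of `L_K(E)` suffice: local finiteness and properness, i.e. `star
a * a = 0` forces `a = 0`. Given both, `h = a * star a` acts on a finite-dimensional space
containing it. Properness makes `h` injective on its own image there, so `h = h * (h * y)`, and `h *
y` is a projection generating `aR` (`isStarRegular_of_locallyFinite`).

Local finiteness (`exists_mem_monoSpan`, `finiteDimensional_monoSpan`) holds because in an acyclic
graph finitely many edges form finitely many paths with a given range, hence finitely many monomials
`p q*` for each middle vertex.

For properness (`proper_of_isPosDefInvolution`), paths with a common range `x` are orthonormal, so a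
combination `a` of them satisfies `star a * a = (∑ star k * k) • x`. This vanishes only for `a = 0`,
by positive definiteness and `vert_ne_zero`. The general case is an induction on the length of the
ghost parts: multiplying `a` on the right by an edge shortens them, so `a` kills every edge, and
then each `a * x` is a combination of real paths (`mul_vert_mem_range_pathComb_of_forall`).

For (ii) ⇒ (i), a `*`-regular ring with suitable local units is proper. In the graph with `n` edges
`eᵢ` into one sink, `∑ xᵢ eᵢ` turns a relation `∑ star xᵢ * xᵢ = 0` in `K` into `star a * a = 0`. -/

/-- If `h` is self-adjoint in a proper `*`-algebra and acts on a finite-dimensional subspace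
containing `h`, then `h = h * (h * y)` for some `y`. -/
theorem exists_eq_mul_mul_of_finiteDimensional {K : Type*} {R : Type*} [Field K] [NonUnitalRing R]
    [StarRing R] [Module K R] [SMulCommClass K R R]
    (hR : ∀ x : R, star x * x = 0 → x = 0) (h : R) (hh : star h = h)
    (A : Submodule K R) [FiniteDimensional K A] (hA : h ∈ A) (hmul : ∀ x ∈ A, h * x ∈ A) :
    ∃ y : R, h = h * (h * y) := by
  let T : A →ₗ[K] A := (LinearMap.mulLeft K h).restrict hmul
  have hT : ∀ x : A, ((T x : A) : R) = h * x := fun x => rfl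
  have hcancel : ∀ x : R, h * (h * x) = 0 → h * x = 0 := fun x hx =>
    hR _ (by rw [star_mul, hh, mul_assoc, hx, mul_zero])
  -- By `hcancel`, `T` is injective on its range; in finite dimension it is therefore onto that
  -- range.
  have hsurj : ∀ x ∈ LinearMap.range T, ∃ y : LinearMap.range T, T y = x := by
    have hinj : Function.Injective
        (T.restrict (p := LinearMap.range T) (q := LinearMap.range T)
          fun x _ => LinearMap.mem_range_self T x) := by
      rw [injective_iff_map_eq_zero]
      rintro ⟨_, ⟨z, rfl⟩⟩ hz
      have hz' : T (T z) = 0 := congrArg Subtype.val hz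
      have : h * (h * (z : R)) = 0 := by
        simpa [hT] using congrArg Subtype.val hz'
      ext
      simpa [hT] using hcancel _ this
    intro x hx
    obtain ⟨y, hy⟩ := LinearMap.surjective_of_injective hinj ⟨x, hx⟩
    exact ⟨y, congrArg Subtype.val hy⟩
  have key : ∀ x ∈ A, ∃ y ∈ A, h * x = h * (h * y) := by
    intro x hx
    obtain ⟨⟨_, ⟨y, rfl⟩⟩, hy⟩ := hsurj (T ⟨x, hx⟩) (LinearMap.mem_range_self _ _)
    exact ⟨y, y.2, by simpa [hT] using (congrArg Subtype.val hy).symm⟩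
  -- `key` at `h` gives `h² = h²y`, properness cancels one `h` to leave `h = hy`, and `key` at `y`
  -- rewrites `hy` as `h²z`.
  obtain ⟨y, hyA, hy⟩ := key h hA
  have hk : h - h * y = 0 := by
    have h0 : h * (h - h * y) = 0 := by rw [mul_sub, ← hy, sub_self]
    refine hR _ ?_
    rw [star_sub, star_mul, hh, sub_mul, mul_assoc, h0, mul_zero, sub_zero]
  obtain ⟨z, -, hz⟩ := key y hyA
  exact ⟨z, by rw [← hz]; exact sub_eq_zero.mp hk⟩

/-- A `*`-algebra with proper involution in which every element acts on a finite-dimensional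
subspace containing it is `*`-regular. -/
theorem isStarRegular_of_locallyFinite {K : Type*} {R : Type w} [Field K] [NonUnitalRing R]
    [StarRing R] [Module K R] [SMulCommClass K R R]
    (hR : ∀ x : R, star x * x = 0 → x = 0)
    (hfin : ∀ h : R, ∃ A : Submodule K R, FiniteDimensional K A ∧ h ∈ A ∧ ∀ x ∈ A, h * x ∈ A) :
    IsStarRegular R := by
  intro a
  obtain ⟨A, _, hA, hmul⟩ := hfin (a * star a)
  have hh : star (a * star a) = a * star a := by simp
  obtain ⟨y, hy⟩ := exists_eq_mul_mul_of_finiteDimensional hR _ hh A hA hmul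
  -- With `h = a * star a` and `p = hy`, the equation `h = hp` gives `star p * h = h`, hence `star p
  -- * p = p`; so `p` is self-adjoint and idempotent.
  obtain ⟨p, hp⟩ : ∃ p, p = a * star a * y := ⟨_, rfl⟩
  rw [← hp] at hy
  have hp1 : star p * (a * star a) = a * star a := by
    conv_lhs => rw [← hh, ← star_mul, ← hy, hh]
  have hp2 : star p * p = p := by
    conv_lhs => rw [hp, ← mul_assoc, ← hp, hp1, ← hp]
  have hsa : star p = p := by
    conv_lhs => rw [← hp2, star_mul, star_star, hp2]
  rw [hsa] at hp1 hp2
  have hpa : p * a = a := by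
    -- Properness is applied to the adjoint of `a - p * a`, so that the expansion involves only `a *
    -- star a`, which `p` fixes on both sides.
    have : star (star a - star a * p) * (star a - star a * p) = 0 := by
      simp only [star_sub, star_star, star_mul, hsa, sub_mul, mul_sub]
      have e1 : a * (star a * p) = a * star a := by rw [← mul_assoc, ← hy]
      have e2 : p * a * star a = a * star a := by rw [mul_assoc, hp1]
      have e3 : p * a * (star a * p) = a * star a := by rw [← mul_assoc, e2, ← hy]
      rw [e1, e2, e3]; simp
    have h0 := congrArg star (sub_eq_zero.mp (hR _ this))
    simpa [hsa] using h0.symm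
  refine ⟨p, ⟨hp2, hsa⟩, Set.Subset.antisymm ?_ ?_⟩
  · rintro _ ⟨x, rfl⟩
    exact ⟨a * x, by simp only [← mul_assoc, hpa]⟩
  · rintro _ ⟨x, rfl⟩
    exact ⟨star a * y * x, by simp only [hp, mul_assoc]⟩

end StarRegular

/-! ### Relations in the Leavitt path algebra and local units. -/

namespace LeavittPathAlgebra

section Basic

variable {K : Type w} [Field K] {E : DirectedGraph.{u, v}}

/-- A property of elements of `L_K(E)` holds if it holds for the generators and is preserved by
sums, products and scalar multiples. -/
theorem induction_on {P : LeavittPathAlgebra K E → Prop} (hzero : P 0)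
    (hgen : ∀ g, P (gen K g)) (hadd : ∀ x y, P x → P y → P (x + y))
    (hmul : ∀ x y, P x → P y → P (x * y)) (hsmul : ∀ (k : K) x, P x → P (k • x))
    (x : LeavittPathAlgebra K E) : P x := by
  have hword : ∀ y : FreeSemigroup (LeavittGen E), P (mk (MonoidAlgebra.single y 1)) := by
    intro y
    induction y using FreeSemigroup.recOnMul with
    | ih1 g => exact hgen g
    | ih2 g y h1 h2 =>
      have := hmul _ _ h1 h2
      rwa [← mk_mul, MonoidAlgebra.single_mul_single, one_mul] at this
  obtain ⟨x, rfl⟩ := mk_surjective x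
  induction x using MonoidAlgebra.induction_linear with
  | zero => exact hzero
  | add x y hx hy => rw [mk_add]; exact hadd _ _ hx hy
  | single y k =>
    have := hsmul k _ (hword y)
    rwa [← mk_smul, MonoidAlgebra.smul_single, smul_eq_mul, mul_one] at this

theorem mk_sum {ι : Type*} (s : Finset ι) (f : ι → FreeLeavitt K E) :
    (mk (∑ i ∈ s, f i) : LeavittPathAlgebra K E) = ∑ i ∈ s, mk (f i) :=
  map_sum (⟨⟨mk, mk_zero⟩, mk_add⟩ : FreeLeavitt K E →+ LeavittPathAlgebra K E) f s

/-- The image of a vertex in `L_K(E)`. -/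
noncomputable abbrev vert (K : Type w) [Field K] {E : DirectedGraph.{u, v}} (x : E.Vertex) :
    LeavittPathAlgebra K E := gen K (.vertex x)

/-- The image of an edge in `L_K(E)`. -/
noncomputable abbrev edge (K : Type w) [Field K] {E : DirectedGraph.{u, v}} (e : E.Edge) :
    LeavittPathAlgebra K E := gen K (.edge e)

/-- The image of a ghost edge in `L_K(E)`. -/
noncomputable abbrev ghost (K : Type w) [Field K] {E : DirectedGraph.{u, v}} (e : E.Edge) :
    LeavittPathAlgebra K E := gen K (.ghost e)

theorem mk_eq_mk_of_rel {a b : FreeLeavitt K E} (h : FreeLeavitt.Rel K E a b) :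
    (mk a : LeavittPathAlgebra K E) = mk b :=
  mk_eq_mk.mpr (FreeLeavitt.con_of_rel h)

theorem vert_mul_self (x : E.Vertex) : vert K x * vert K x = vert K x :=
  mk_eq_mk_of_rel (.vertex_mul_self x)

theorem vert_mul_of_ne {x y : E.Vertex} (h : x ≠ y) : vert K x * vert K y = 0 :=
  mk_eq_mk_of_rel (.vertex_mul_of_ne x y h)

theorem source_mul_edge (e : E.Edge) : vert K (E.s e) * edge K e = edge K e :=
  mk_eq_mk_of_rel (.source_mul_edge e)

theorem edge_mul_range (e : E.Edge) : edge K e * vert K (E.r e) = edge K e :=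
  mk_eq_mk_of_rel (.edge_mul_range e)

theorem range_mul_ghost (e : E.Edge) : vert K (E.r e) * ghost K e = ghost K e :=
  mk_eq_mk_of_rel (.range_mul_ghost e)

theorem ghost_mul_source (e : E.Edge) : ghost K e * vert K (E.s e) = ghost K e :=
  mk_eq_mk_of_rel (.ghost_mul_source e)

theorem ghost_mul_edge_self (e : E.Edge) : ghost K e * edge K e = vert K (E.r e) :=
  mk_eq_mk_of_rel (.ghost_mul_edge_self e)

theorem ghost_mul_edge_of_ne {e f : E.Edge} (h : e ≠ f) : ghost K e * edge K f = 0 :=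
  mk_eq_mk_of_rel (.ghost_mul_edge_of_ne e f h)

theorem vert_eq_sum (x : E.Vertex) (hfin : {e : E.Edge | E.s e = x}.Finite)
    (hne : {e : E.Edge | E.s e = x}.Nonempty) :
    vert K x = ∑ e ∈ hfin.toFinset, edge K e * ghost K e :=
  (mk_eq_mk_of_rel (.vertex_eq_sum x hfin hne)).trans (mk_sum _ _)

theorem vert_mul_edge_of_ne {x : E.Vertex} {e : E.Edge} (h : x ≠ E.s e) :
    vert K x * edge K e = 0 := by
  rw [← source_mul_edge, ← mul_assoc, vert_mul_of_ne h, zero_mul]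

theorem ghost_mul_vert_of_ne {x : E.Vertex} {e : E.Edge} (h : E.s e ≠ x) :
    ghost K e * vert K x = 0 := by
  rw [← ghost_mul_source, mul_assoc, vert_mul_of_ne h, mul_zero]

/-- The sums of distinct vertices are local units, on the right. -/
theorem eq_zero_of_forall_mul_vert (a : LeavittPathAlgebra K E)
    (ha : ∀ x : E.Vertex, a * vert K x = 0) : a = 0 := by
  classical
  have key : ∀ a : LeavittPathAlgebra K E,
      ∃ T₀ : Finset E.Vertex, ∀ T, T₀ ⊆ T → a * ∑ x ∈ T, vert K x = a := by
    refine induction_on ⟨∅, fun T _ => zero_mul _⟩ ?_ ?_ ?_ ?_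
    · have aux : ∀ (g : LeavittPathAlgebra K E) (x : E.Vertex), g * vert K x = g →
          ∃ T₀ : Finset E.Vertex, ∀ T, T₀ ⊆ T → g * ∑ x ∈ T, vert K x = g := by
        intro g x hg
        refine ⟨{x}, fun T hT => ?_⟩
        rw [← hg, mul_assoc, Finset.mul_sum, Finset.sum_eq_single x, vert_mul_self]
        · exact fun y _ hy => vert_mul_of_ne hy.symm
        · exact fun hx => absurd (hT (Finset.mem_singleton_self x)) hx
      rintro (x | e | e)
      · exact aux _ _ (vert_mul_self x)
      · exact aux _ _ (edge_mul_range e)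
      · exact aux _ _ (ghost_mul_source e)
    · rintro x y ⟨T₁, h₁⟩ ⟨T₂, h₂⟩
      refine ⟨T₁ ∪ T₂, fun T hT => ?_⟩
      rw [add_mul, h₁ T (Finset.union_subset_left hT), h₂ T (Finset.union_subset_right hT)]
    · rintro x y - ⟨T₂, h₂⟩
      exact ⟨T₂, fun T hT => by rw [mul_assoc, h₂ T hT]⟩
    · rintro k x ⟨T₁, h₁⟩
      exact ⟨T₁, fun T hT => by rw [smul_mul_assoc, h₁ T hT]⟩
  obtain ⟨T, hT⟩ := key a
  rw [← hT T subset_rfl, Finset.mul_sum]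
  exact Finset.sum_eq_zero fun x _ => ha x

end Basic

/-! ### A representation in which the vertices are nonzero. -/

section Nonzero

variable {K : Type w} [Field K] {E : DirectedGraph.{u, v}}

/-- A family of elements of a nonunital algebra satisfying the defining relations induces a map
on `L_K(E)` which respects scalar multiples and sends each generator to the given element. -/
theorem exists_lift {A : Type*} [NonUnitalRing A] [Module K A] [IsScalarTower K A A]
    [SMulCommClass K A A] (φ : LeavittGen E → A)
    (h1 : ∀ x, φ (.vertex x) * φ (.vertex x) = φ (.vertex x))
    (h2 : ∀ x y, x ≠ y → φ (.vertex x) * φ (.vertex y) = 0)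
    (h3 : ∀ e, φ (.vertex (E.s e)) * φ (.edge e) = φ (.edge e))
    (h4 : ∀ e, φ (.edge e) * φ (.vertex (E.r e)) = φ (.edge e))
    (h5 : ∀ e, φ (.vertex (E.r e)) * φ (.ghost e) = φ (.ghost e))
    (h6 : ∀ e, φ (.ghost e) * φ (.vertex (E.s e)) = φ (.ghost e))
    (h7 : ∀ e, φ (.ghost e) * φ (.edge e) = φ (.vertex (E.r e)))
    (h8 : ∀ e f, e ≠ f → φ (.ghost e) * φ (.edge f) = 0)
    (h9 : ∀ (x : E.Vertex) (hfin : {e : E.Edge | E.s e = x}.Finite),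
      {e : E.Edge | E.s e = x}.Nonempty →
      φ (.vertex x) = ∑ e ∈ hfin.toFinset, φ (.edge e) * φ (.ghost e)) :
    ∃ Φ : LeavittPathAlgebra K E → A, Φ 0 = 0 ∧ ∀ g, Φ (gen K g) = φ g := by
  let ψ : FreeLeavitt K E →ₙₐ[K] A := MonoidAlgebra.liftMagma K (FreeSemigroup.lift φ)
  have hψ : ∀ g, ψ (FreeLeavitt.gen K E g) = φ g := by
    intro g
    simp [ψ, FreeLeavitt.gen, MonoidAlgebra.liftMagma]
  have hrel : ∀ a b, FreeLeavitt.Rel K E a b → ψ a = ψ b := by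
    intro a b h
    cases h <;> simp only [map_mul, map_sum, map_zero, hψ]
    · exact h1 _
    · exact h2 _ _ ‹_›
    · exact h3 _
    · exact h4 _
    · exact h5 _
    · exact h6 _
    · exact h7 _
    · exact h8 _ _ ‹_›
    · exact h9 _ _ ‹_›
  have hcon : ∀ a b, FreeLeavitt.con K E a b → ψ a = ψ b := by
    intro a b h
    change RingConGen.Rel _ a b at h
    induction h with
    | of x y h =>
      obtain ⟨k, a, b, h, rfl, rfl⟩ := h
      rw [map_smul, map_smul, hrel _ _ h]
    | refl x => rfl
    | symm _ ih => exact ih.symm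
    | trans _ _ ih₁ ih₂ => exact ih₁.trans ih₂
    | add _ _ ih₁ ih₂ => rw [map_add, map_add, ih₁, ih₂]
    | mul _ _ ih₁ ih₂ => rw [map_mul, map_mul, ih₁, ih₂]
  exact ⟨fun x => Quotient.liftOn' x ψ hcon, map_zero ψ, hψ⟩

/-- An infinite set `X` with, for each vertex `x`, an injection of `s⁻¹(x) × X` into `X` which is
onto unless `x` is a sink. -/
theorem exists_branching (E : DirectedGraph.{u, v}) :
    ∃ (X : Type v) (c : E.Edge → X → X), Nonempty X ∧
      (∀ e f x y, E.s e = E.s f → c e x = c f y → e = f ∧ x = y) ∧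
      ∀ e x, ∃ f y, E.s f = E.s e ∧ c f y = x := by
  -- The summand `ℕ` makes `X` infinite and the summand `E.Edge` makes it at least as large as every
  -- `s⁻¹(x)`, so `|s⁻¹(x)| · |X| = |X|` for `s⁻¹(x)` nonempty.
  let X := E.Edge ⊕ ULift.{v} ℕ
  have hX : Cardinal.aleph0 ≤ Cardinal.mk X := Cardinal.aleph0_le_mk X
  have hequiv : ∀ x : E.Vertex, Nonempty {e : E.Edge // E.s e = x} →
      Nonempty ({e : E.Edge // E.s e = x} × X ≃ X) := by
    intro x hne
    have hle : Cardinal.mk {e : E.Edge // E.s e = x} ≤ Cardinal.mk X :=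
      Cardinal.mk_le_of_injective (f := fun e => Sum.inl e.1)
        (Sum.inl_injective.comp Subtype.val_injective)
    refine Cardinal.eq.mp ?_
    rw [← Cardinal.mul_def, Cardinal.mul_eq_right hX hle (Cardinal.mk_ne_zero _)]
  let ψ := fun x hx => (hequiv x hx).some
  let c : E.Edge → X → X := fun e x => ψ (E.s e) ⟨⟨e, rfl⟩⟩ (⟨e, rfl⟩, x)
  -- Replacing `E.s e` by a free vertex `u` lets the values at two edges with equal sources be
  -- compared through one bijection.
  have hc : ∀ (u : E.Vertex) (e : E.Edge) (he : E.s e = u) (x : X),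
      c e x = ψ u ⟨⟨e, he⟩⟩ (⟨e, he⟩, x) := by
    rintro _ e rfl x
    rfl
  refine ⟨X, c, ⟨Sum.inr ⟨0⟩⟩, fun e f x y hef h => ?_, fun e x => ?_⟩
  · rw [hc _ e hef, hc _ f rfl] at h
    have := (ψ (E.s f) ⟨⟨f, rfl⟩⟩).injective h
    simpa using this
  · obtain ⟨⟨⟨f, hf⟩, y⟩, h⟩ := (ψ (E.s e) ⟨⟨e, rfl⟩⟩).surjective x
    exact ⟨f, y, hf, by rw [hc _ f hf, h]⟩

/-- The vertices are nonzero in the Leavitt path algebra of any graph. -/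
theorem vert_ne_zero (x : E.Vertex) : vert K x ≠ 0 := by
  classical
  obtain ⟨X, c, ⟨x₀⟩, hinj, hsurj⟩ := exists_branching E
  -- The algebra acts on functions on `E⁰ × X`. A vertex `u` restricts to the block `{u} × X`; an
  -- edge `e` transports the block of `r(e)` into the block of `s(e)` along `ι e`, and `e*`
  -- transports back. The images of the `ι e` are disjoint, which gives (CK1), and those with `s(e)
  -- = u` cover the block of `u` unless `u` is a sink, which gives (CK2).
  let ι : E.Edge → X → E.Vertex × X := fun e x => (E.s e, c e x)
  have hι : ∀ e f x y, ι e x = ι f y → e = f ∧ x = y := by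
    intro e f x y h
    simp only [ι, Prod.mk.injEq] at h
    exact hinj e f x y h.1 h.2
  let pv : E.Vertex → Module.End K (E.Vertex × X → K) := fun u =>
    { toFun := fun f p => if p.1 = u then f p else 0
      map_add' := fun f g => by ext p; simp only [Pi.add_apply]; split_ifs <;> simp
      map_smul' := fun k f => by ext p; simp }
  let pe : E.Edge → Module.End K (E.Vertex × X → K) := fun e =>
    (Function.ExtendByZero.linearMap K (ι e)).comp
      (LinearMap.funLeft K K fun x => (E.r e, x))
  let pg : E.Edge → Module.End K (E.Vertex × X → K) := fun e =>
    { toFun := fun f p => if p.1 = E.r e then f (ι e p.2) else 0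
      map_add' := fun f g => by ext p; simp only [Pi.add_apply]; split_ifs <;> simp
      map_smul' := fun k f => by ext p; simp }
  have hpv : ∀ u f p, pv u f p = if p.1 = u then f p else 0 := fun _ _ _ => rfl
  have hpg : ∀ e f p, pg e f p = if p.1 = E.r e then f (ι e p.2) else 0 := fun _ _ _ => rfl
  have hpe : ∀ e f y, pe e f (ι e y) = f (E.r e, y) := fun e f y =>
    Function.Injective.extend_apply (fun a b h => (hι e e a b h).2) _ _ _
  have hpe0 : ∀ e f p, (¬ ∃ y, ι e y = p) → pe e f p = 0 := fun e f p h =>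
    Function.extend_apply' _ _ _ h
  let φ : LeavittGen E → Module.End K (E.Vertex × X → K)
    | .vertex u => pv u
    | .edge e => pe e
    | .ghost e => pg e
  obtain ⟨Φ, hΦ0, hΦ⟩ : ∃ Φ : LeavittPathAlgebra K E → Module.End K (E.Vertex × X → K),
      Φ 0 = 0 ∧ ∀ g, Φ (gen K g) = φ g := by
    refine exists_lift (K := K) φ ?_ ?_ ?_ ?_ ?_ ?_ ?_ ?_ ?_ <;> dsimp only [φ]
    · intro u; ext1 f; funext p
      simp only [Module.End.mul_apply, hpv]
      split_ifs <;> rfl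
    · intro u w h; ext1 f; funext p
      simp only [Module.End.mul_apply, hpv]
      split_ifs with h1 h2
      · exact absurd (h1.symm.trans h2) h
      all_goals rfl
    · intro e; ext1 f; funext p
      simp only [Module.End.mul_apply, hpv]
      split_ifs with h1
      · rfl
      · rw [hpe0]
        rintro ⟨y, rfl⟩
        exact h1 rfl
    · intro e; ext1 f; funext p
      simp only [Module.End.mul_apply]
      by_cases hp : ∃ y, ι e y = p
      · obtain ⟨y, rfl⟩ := hp
        rw [hpe, hpe, hpv, if_pos rfl]
      · rw [hpe0 _ _ _ hp, hpe0 _ _ _ hp]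
    · intro e; ext1 f; funext p
      simp only [Module.End.mul_apply, hpv, hpg]
      split_ifs <;> rfl
    · intro e; ext1 f; funext p
      simp only [Module.End.mul_apply, hpv, hpg, ι, if_true]
    · intro e; ext1 f; funext p
      simp only [Module.End.mul_apply, hpv, hpg]
      split_ifs with h
      · rw [hpe, ← h]
      · rfl
    · intro e f h; ext1 g; funext p
      simp only [Module.End.mul_apply, hpg]
      split_ifs
      · rw [hpe0]
        · rfl
        · rintro ⟨y, hy⟩
          exact h (hι _ _ _ _ hy).1.symm
      · rfl
    · intro u hfin hne; ext1 g; funext p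
      simp only [LinearMap.sum_apply, Finset.sum_apply, Module.End.mul_apply, hpv]
      split_ifs with h
      · obtain ⟨e, he⟩ := hne
        obtain ⟨f, y, hf, hy⟩ := hsurj e p.2
        have hfu : E.s f = u := hf.trans he
        have hp : ι f y = p := Prod.ext (hfu.trans h.symm) hy
        rw [Finset.sum_eq_single f, ← hp, hpe, hpg, if_pos rfl]
        · rintro b - hb
          rw [hpe0]
          rintro ⟨z, hz⟩
          exact hb (hι _ _ _ _ (hz.trans hp.symm)).1
        · intro hn
          exact absurd (hfin.mem_toFinset.mpr hfu) hn
      · symm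
        refine Finset.sum_eq_zero fun e he => hpe0 _ _ _ ?_
        rintro ⟨y, rfl⟩
        exact h (hfin.mem_toFinset.mp he)
  intro h
  have h1 := hΦ (.vertex x)
  rw [show gen K (.vertex x) = 0 from h, hΦ0] at h1
  have h2 : (0 : K) = if x = x then 1 else 0 :=
    congrFun (LinearMap.congr_fun h1 fun _ => 1) (x, x₀)
  simp at h2

theorem smul_vert_eq_zero {k : K} {x : E.Vertex} (h : k • vert K x = 0) : k = 0 :=
  (smul_eq_zero.mp h).resolve_right (vert_ne_zero x)

theorem smul_edge_eq_zero {k : K} {e : E.Edge} (h : k • edge K e = 0) : k = 0 := by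
  refine smul_vert_eq_zero (x := E.r e) ?_
  rw [← ghost_mul_edge_self, ← mul_smul_comm, h, mul_zero]

end Nonzero

end LeavittPathAlgebra

/-! ### Paths in acyclic graphs. -/

namespace DirectedGraph

variable {E : DirectedGraph.{u, v}}

/-- The source of the path with the given list of edges and range `x`. -/
def src (E : DirectedGraph.{u, v}) : List E.Edge → E.Vertex → E.Vertex
  | [], x => x
  | e :: _, _ => E.s e

/-- The list of edges is a path with range `x`. -/
def IsPath (E : DirectedGraph.{u, v}) : List E.Edge → E.Vertex → Prop
  | [], _ => True
  | e :: p, x => E.r e = E.src p x ∧ E.IsPath p x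

theorem IsPath.isChain {p : List E.Edge} {x : E.Vertex} (h : E.IsPath p x) :
    p.IsChain fun e f => E.r e = E.s f := by
  induction p with
  | nil => exact List.isChain_nil
  | cons e p ih =>
    cases p with
    | nil => exact List.isChain_singleton _
    | cons f p => exact List.isChain_cons_cons.mpr ⟨h.1, ih h.2⟩

theorem IsPath.range_getLast {p : List E.Edge} {x : E.Vertex} (h : E.IsPath p x) (hp : p ≠ []) :
    E.r (p.getLast hp) = x := by
  induction p with
  | nil => exact absurd rfl hp
  | cons e p ih =>
    cases p with
    | nil => exact h.1
    | cons f p =>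
      rw [List.getLast_cons (List.cons_ne_nil f p)]
      exact ih h.2 _

theorem IsPath.of_append {p q : List E.Edge} {e : E.Edge} {x : E.Vertex}
    (h : E.IsPath (p ++ e :: q) x) : E.IsPath p (E.s e) := by
  induction p with
  | nil => trivial
  | cons f p ih =>
    refine ⟨?_, ih h.2⟩
    have := h.1
    cases p <;> exact this

theorem IsPath.isCycle {p : List E.Edge} {e : E.Edge} (h : E.IsPath (e :: p) (E.s e))
    (hn : ((e :: p).map E.s).Nodup) : E.IsCycle (e :: p) :=
  ⟨h.isChain, ⟨List.cons_ne_nil _ _, (h.range_getLast _).symm⟩, hn⟩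

/-- If the source of the first edge recurred at a later edge `f`, the segment before `f` would be a
closed path. Its sources are distinct by induction, so it would be a cycle. -/
theorem Acyclic.nodup (hE : E.Acyclic) {p : List E.Edge} {x : E.Vertex} (h : E.IsPath p x) :
    (p.map E.s).Nodup := by
  induction p with
  | nil => exact List.nodup_nil
  | cons e p ih =>
    have hp := ih h.2
    rw [List.map_cons, List.nodup_cons]
    refine ⟨fun hmem => ?_, hp⟩
    obtain ⟨f, hf, hfe⟩ := List.mem_map.mp hmem
    obtain ⟨l₁, l₂, rfl⟩ := List.append_of_mem hf
    have h' : E.IsPath (e :: l₁) (E.s f) := IsPath.of_append (p := e :: l₁) h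
    rw [hfe] at h'
    rw [List.map_append, List.map_cons, hfe] at hp
    refine hE _ (h'.isCycle ?_)
    rw [List.map_cons, List.nodup_cons]
    refine ⟨fun hm => ?_, hp.of_append_left⟩
    exact (List.disjoint_of_nodup_append hp) hm List.mem_cons_self

theorem Acyclic.source_ne (hE : E.Acyclic) {e : E.Edge} {p : List E.Edge} {x : E.Vertex}
    (h : E.IsPath (e :: p) x) : E.s e ≠ x := by
  rintro rfl
  exact hE _ (h.isCycle (hE.nodup h))

/-- In an acyclic graph, finitely many edges form finitely many paths with a given range. -/
theorem Acyclic.finite_setOf_isPath (hE : E.Acyclic) (F : Finset E.Edge) (x : E.Vertex) :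
    {p : List E.Edge | E.IsPath p x ∧ ∀ e ∈ p, e ∈ F}.Finite := by
  refine (List.finite_length_le F F.card).image (List.map Subtype.val) |>.subset ?_
  rintro p ⟨hp, hF⟩
  refine ⟨p.attach.map fun e => ⟨e.1, hF _ e.2⟩, ?_, ?_⟩
  · have hn : p.Nodup := (hE.nodup hp).of_map
    classical
    have := Finset.card_le_card (s := p.toFinset) (t := F) fun e he => hF e (by simpa using he)
    rw [List.toFinset_card_of_nodup hn] at this
    simpa using this
  · simp [List.map_map, Function.comp_def]

end DirectedGraph

/-! ### Monomials `p q*` and local finiteness. -/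

namespace LeavittPathAlgebra

variable {K : Type w} [Field K] {E : DirectedGraph.{u, v}}

/-- The element `e₁ ⋯ eₙ x` of `L_K(E)`. -/
noncomputable def path (K : Type w) [Field K] {E : DirectedGraph.{u, v}} :
    List E.Edge → E.Vertex → LeavittPathAlgebra K E
  | [], x => vert K x
  | e :: p, x => edge K e * path K p x

theorem vert_mul_path (p : List E.Edge) (x : E.Vertex) :
    vert K (E.src p x) * path K p x = path K p x := by
  cases p with
  | nil => exact vert_mul_self x
  | cons e p => rw [path, DirectedGraph.src, ← mul_assoc, source_mul_edge]

theorem vert_mul_path_of_ne {p : List E.Edge} {x y : E.Vertex} (h : y ≠ E.src p x) :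
    vert K y * path K p x = 0 := by
  rw [← vert_mul_path, ← mul_assoc, vert_mul_of_ne h, zero_mul]

theorem path_mul_vert (p : List E.Edge) (x : E.Vertex) :
    path K p x * vert K x = path K p x := by
  induction p with
  | nil => exact vert_mul_self x
  | cons e p ih => rw [path, mul_assoc, ih]

theorem path_mul_vert_of_ne {p : List E.Edge} {x y : E.Vertex} (h : x ≠ y) :
    path K p x * vert K y = 0 := by
  rw [← path_mul_vert, mul_assoc, vert_mul_of_ne h, mul_zero]

/-- Where two consecutive edges do not match, a product of two distinct vertices can be inserted.
Arbitrary lists of edges may therefore be used in monomials. -/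
theorem path_eq_zero {p : List E.Edge} {x : E.Vertex} (h : ¬ E.IsPath p x) : path K p x = 0 := by
  induction p with
  | nil => exact absurd trivial h
  | cons e p ih =>
    rw [path]
    by_cases hp : E.IsPath p x
    · rw [← edge_mul_range, mul_assoc, vert_mul_path_of_ne, mul_zero]
      exact fun he => h ⟨he, hp⟩
    · rw [ih hp, mul_zero]

/-- The adjoint `x eₙ* ⋯ e₁*` of `path K [e₁, …, eₙ] x`. -/
noncomputable def gpath (K : Type w) [Field K] {E : DirectedGraph.{u, v}} :
    List E.Edge → E.Vertex → LeavittPathAlgebra K E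
  | [], x => vert K x
  | e :: p, x => gpath K p x * ghost K e

theorem gpath_mul_vert (p : List E.Edge) (x : E.Vertex) :
    gpath K p x * vert K (E.src p x) = gpath K p x := by
  cases p with
  | nil => exact vert_mul_self x
  | cons e p => rw [gpath, DirectedGraph.src, mul_assoc, ghost_mul_source]

theorem gpath_mul_vert_of_ne {p : List E.Edge} {x y : E.Vertex} (h : E.src p x ≠ y) :
    gpath K p x * vert K y = 0 := by
  rw [← gpath_mul_vert, mul_assoc, vert_mul_of_ne h, mul_zero]

theorem gpath_eq_zero {p : List E.Edge} {x : E.Vertex} (h : ¬ E.IsPath p x) :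
    gpath K p x = 0 := by
  induction p with
  | nil => exact absurd trivial h
  | cons e p ih =>
    rw [gpath]
    by_cases hp : E.IsPath p x
    · rw [← range_mul_ghost, ← mul_assoc, gpath_mul_vert_of_ne, zero_mul]
      exact fun he => h ⟨he.symm, hp⟩
    · rw [ih hp, zero_mul]

theorem star_path [StarRing K] (p : List E.Edge) (x : E.Vertex) :
    star (path K p x) = gpath K p x := by
  induction p with
  | nil => exact star_gen _
  | cons e p ih => rw [path, gpath, star_mul, ih]; exact congrArg _ (star_gen _)

/-- In an acyclic graph, the paths with a common range are orthonormal. -/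
theorem gpath_mul_path [DecidableEq E.Edge] (hE : E.Acyclic) {p q : List E.Edge} {x : E.Vertex}
    (hp : E.IsPath p x) (hq : E.IsPath q x) :
    gpath K p x * path K q x = if p = q then vert K x else 0 := by
  induction p generalizing q with
  | nil =>
    cases q with
    | nil => exact vert_mul_self x
    -- Once one path is exhausted, the rest of the other is a nonempty path ending at `x`; by
    -- acyclicity it does not start at `x`.
    | cons f q => exact vert_mul_path_of_ne (hE.source_ne hq).symm
  | cons e p ih =>
    cases q with
    | nil => exact gpath_mul_vert_of_ne (hE.source_ne hp)
    | cons f q =>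
      rw [gpath, path, mul_assoc, ← mul_assoc (ghost K e)]
      by_cases hef : e = f
      · subst hef
        rw [ghost_mul_edge_self, ← mul_assoc, hp.1, gpath_mul_vert, ih hp.2 hq.2]
        simp
      · rw [ghost_mul_edge_of_ne hef, zero_mul, mul_zero, if_neg]
        exact fun h => hef (List.cons.inj h).1

/-- The element `e₁ ⋯ eₙ x fₘ* ⋯ f₁*` of `L_K(E)`. -/
noncomputable def mono (K : Type w) [Field K] {E : DirectedGraph.{u, v}}
    (p : List E.Edge) (x : E.Vertex) (q : List E.Edge) : LeavittPathAlgebra K E :=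
  path K p x * gpath K q x

theorem vert_mul_mono (y : E.Vertex) (p : List E.Edge) (x : E.Vertex) (q : List E.Edge) :
    vert K y * mono K p x q = mono K p x q ∨ vert K y * mono K p x q = 0 := by
  rw [mono, ← mul_assoc]
  by_cases h : y = E.src p x
  · left; rw [h, vert_mul_path]
  · right; rw [vert_mul_path_of_ne h, zero_mul]

theorem mono_mul_vert (y : E.Vertex) (p : List E.Edge) (x : E.Vertex) (q : List E.Edge) :
    mono K p x q * vert K y = mono K p x q ∨ mono K p x q * vert K y = 0 := by
  rw [mono, mul_assoc]
  by_cases h : E.src q x = y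
  · left; rw [← h, gpath_mul_vert]
  · right; rw [gpath_mul_vert_of_ne h, mul_zero]

/-- The span of the monomials with edges in `F` and middle vertex in `W` or an end of an edge
in `F`. -/
noncomputable def monoSpan (K : Type w) [Field K] {E : DirectedGraph.{u, v}}
    (F : Set E.Edge) (W : Set E.Vertex) : Submodule K (LeavittPathAlgebra K E) :=
  Submodule.span K {a | ∃ p x q, E.IsPath p x ∧ E.IsPath q x ∧ (∀ e ∈ p, e ∈ F) ∧
    (∀ e ∈ q, e ∈ F) ∧ x ∈ W ∪ E.s '' F ∪ E.r '' F ∧ a = mono K p x q}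

theorem mono_mem_monoSpan {F : Set E.Edge} {W : Set E.Vertex} {p q : List E.Edge} {x : E.Vertex}
    (hp : ∀ e ∈ p, e ∈ F) (hq : ∀ e ∈ q, e ∈ F) (hx : x ∈ W ∪ E.s '' F ∪ E.r '' F) :
    mono K p x q ∈ monoSpan K F W := by
  by_cases h1 : E.IsPath p x
  · by_cases h2 : E.IsPath q x
    · exact Submodule.subset_span ⟨p, x, q, h1, h2, hp, hq, hx, rfl⟩
    · rw [mono, gpath_eq_zero h2, mul_zero]; exact zero_mem _
  · rw [mono, path_eq_zero h1, zero_mul]; exact zero_mem _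

/-- The generating set is finite: there are finitely many middle vertices, and for each of them
finitely many paths with edges in `F`. -/
theorem finiteDimensional_monoSpan (hE : E.Acyclic) (F : Finset E.Edge) (W : Finset E.Vertex) :
    FiniteDimensional K (monoSpan K (F : Set E.Edge) (W : Set E.Vertex)) := by
  refine FiniteDimensional.span_of_finite K ?_
  have hV : ((W : Set E.Vertex) ∪ E.s '' F ∪ E.r '' F).Finite :=
    (W.finite_toSet.union (F.finite_toSet.image _)).union (F.finite_toSet.image _)
  refine (hV.biUnion fun x _ => ((hE.finite_setOf_isPath F x).prod
    (hE.finite_setOf_isPath F x)).image fun pq => mono K pq.1 x pq.2).subset ?_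
  rintro _ ⟨p, x, q, h1, h2, hp, hq, hx, rfl⟩
  exact Set.mem_biUnion hx ⟨(p, q), ⟨⟨h1, hp⟩, ⟨h2, hq⟩⟩, rfl⟩

/-- The generators that are edges in `F`, ghost edges in `F` or vertices in `W`. -/
def GenIn (F : Set E.Edge) (W : Set E.Vertex) : LeavittGen E → Prop
  | .vertex x => x ∈ W
  | .edge e => e ∈ F
  | .ghost e => e ∈ F

theorem gen_mem_monoSpan {F : Set E.Edge} {W : Set E.Vertex} {g : LeavittGen E}
    (hg : GenIn F W g) : gen K g ∈ monoSpan K F W := by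
  cases g with
  | vertex x =>
    have : gen K (.vertex x) = mono K [] x [] := (vert_mul_self x).symm
    rw [this]
    exact mono_mem_monoSpan (by simp) (by simp) (Or.inl (Or.inl hg))
  | edge e =>
    have : gen K (.edge e) = mono K [e] (E.r e) [] := by
      simp only [mono, path, gpath, edge_mul_range]
    rw [this]
    exact mono_mem_monoSpan (by simpa using (show e ∈ F from hg)) (by simp) (Or.inr ⟨e, hg, rfl⟩)
  | ghost e =>
    have : gen K (.ghost e) = mono K [] (E.r e) [e] := by
      simp only [mono, path, gpath, range_mul_ghost]
    rw [this]
    exact mono_mem_monoSpan (by simp) (by simpa using (show e ∈ F from hg)) (Or.inr ⟨e, hg, rfl⟩)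

/-- Handles `e*` meeting a monomial with trivial real part. The edge goes to the end of `q` because
`gpath` reverses the order. -/
theorem ghost_mul_gpath (x y : E.Vertex) (q : List E.Edge) (e : E.Edge)
    (he : E.s e = x) (hy : E.r e = y) :
    ghost K e * gpath K q x = gpath K (q ++ [e]) y := by
  subst he hy
  induction q with
  | nil => simp only [gpath, List.nil_append, ghost_mul_source, range_mul_ghost]
  | cons f q ih => rw [gpath, ← mul_assoc, ih, List.cons_append, gpath]

/-- A generator prepends an edge to the real part, cancels its first edge, lengthens the ghost part,
or acts on the monomial as identity or zero. No edge outside `F` appears, and the middle vertex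
changes only to some `r(e)` with `e ∈ F`, which `monoSpan` admits. -/
theorem gen_mul_mem_monoSpan {F : Set E.Edge} {W : Set E.Vertex} {g : LeavittGen E}
    (hg : GenIn F W g) {a : LeavittPathAlgebra K E} (ha : a ∈ monoSpan K F W) :
    gen K g * a ∈ monoSpan K F W := by
  refine Submodule.span_induction (p := fun a _ => gen K g * a ∈ monoSpan K F W) ?_ ?_ ?_ ?_ ha
  · rintro _ ⟨p, x, q, h1, h2, hp, hq, hx, rfl⟩
    have hvert : ∀ y : E.Vertex, ∀ p : List E.Edge, (∀ e ∈ p, e ∈ F) →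
        vert K y * mono K p x q ∈ monoSpan K F W := by
      intro y p hp
      rcases vert_mul_mono (K := K) y p x q with h | h <;> rw [h]
      · exact mono_mem_monoSpan hp hq hx
      · exact zero_mem _
    cases g with
    | vertex y => exact hvert y p hp
    | edge e =>
      have : gen K (.edge e) * mono K p x q = mono K (e :: p) x q := by
        rw [mono, mono, path, mul_assoc]
      rw [this]
      refine mono_mem_monoSpan ?_ hq hx
      rintro f (_ | ⟨_, hf⟩)
      · exact hg
      · exact hp f hf
    | ghost e =>
      cases p with
      | nil =>
        rw [mono, path, ← mul_assoc]
        by_cases hs : E.s e = x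
        · have : ghost K e * vert K x * gpath K q x = mono K [] (E.r e) (q ++ [e]) := by
            rw [mono, path, ← ghost_mul_gpath x (E.r e) q e hs rfl, ← mul_assoc,
              range_mul_ghost, ← hs, ghost_mul_source]
          rw [this]
          refine mono_mem_monoSpan (by simp) ?_ (Or.inr ⟨e, hg, rfl⟩)
          intro f hf
          rcases List.mem_append.mp hf with hf | hf
          · exact hq f hf
          · rw [List.mem_singleton.mp hf]; exact hg
        · rw [ghost_mul_vert_of_ne hs, zero_mul]; exact zero_mem _
      | cons f p =>
        rw [mono, path, mul_assoc, ← mul_assoc]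
        by_cases hef : e = f
        · subst hef
          rw [ghost_mul_edge_self]
          exact hvert _ p fun f hf => hp f (List.mem_cons_of_mem _ hf)
        · rw [ghost_mul_edge_of_ne hef, zero_mul]; exact zero_mem _
  · rw [mul_zero]; exact zero_mem _
  · intro x y _ _ hx hy
    rw [mul_add]; exact add_mem hx hy
  · intro k x _ hx
    rw [mul_smul_comm]; exact Submodule.smul_mem _ _ hx

/-- Every element lies in, and acts on, the span of the monomials in any sufficiently large
finite set of edges and vertices. -/
theorem exists_mem_monoSpan (h : LeavittPathAlgebra K E) :
    ∃ (F₀ : Finset E.Edge) (W₀ : Finset E.Vertex), ∀ (F : Set E.Edge) (W : Set E.Vertex),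
      (F₀ : Set E.Edge) ⊆ F → (W₀ : Set E.Vertex) ⊆ W →
      h ∈ monoSpan K F W ∧ ∀ a ∈ monoSpan K F W, h * a ∈ monoSpan K F W := by
  classical
  induction h using induction_on with
  | hzero =>
    exact ⟨∅, ∅, fun F W _ _ => ⟨zero_mem _, fun a _ => by rw [zero_mul]; exact zero_mem _⟩⟩
  | hgen g =>
    obtain ⟨F₀, W₀, h₀⟩ : ∃ (F₀ : Finset E.Edge) (W₀ : Finset E.Vertex),
        ∀ (F : Set E.Edge) (W : Set E.Vertex), (F₀ : Set E.Edge) ⊆ F →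
          (W₀ : Set E.Vertex) ⊆ W → GenIn F W g := by
      cases g with
      | vertex x => exact ⟨∅, {x}, fun F W _ hW => hW (by simp)⟩
      | edge e => exact ⟨{e}, ∅, fun F W hF _ => hF (by simp)⟩
      | ghost e => exact ⟨{e}, ∅, fun F W hF _ => hF (by simp)⟩
    exact ⟨F₀, W₀, fun F W hF hW =>
      ⟨gen_mem_monoSpan (h₀ F W hF hW), fun a => gen_mul_mem_monoSpan (h₀ F W hF hW)⟩⟩
  | hadd x y hx hy =>
    obtain ⟨F₁, W₁, h₁⟩ := hx
    obtain ⟨F₂, W₂, h₂⟩ := hy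
    refine ⟨F₁ ∪ F₂, W₁ ∪ W₂, fun F W hF hW => ?_⟩
    rw [Finset.coe_union, Set.union_subset_iff] at hF hW
    obtain ⟨m₁, a₁⟩ := h₁ F W hF.1 hW.1
    obtain ⟨m₂, a₂⟩ := h₂ F W hF.2 hW.2
    exact ⟨add_mem m₁ m₂, fun a ha => by rw [add_mul]; exact add_mem (a₁ a ha) (a₂ a ha)⟩
  | hmul x y hx hy =>
    obtain ⟨F₁, W₁, h₁⟩ := hx
    obtain ⟨F₂, W₂, h₂⟩ := hy
    refine ⟨F₁ ∪ F₂, W₁ ∪ W₂, fun F W hF hW => ?_⟩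
    rw [Finset.coe_union, Set.union_subset_iff] at hF hW
    obtain ⟨m₁, a₁⟩ := h₁ F W hF.1 hW.1
    obtain ⟨m₂, a₂⟩ := h₂ F W hF.2 hW.2
    exact ⟨a₁ y m₂, fun a ha => by rw [mul_assoc]; exact a₁ _ (a₂ a ha)⟩
  | hsmul k x hx =>
    obtain ⟨F₁, W₁, h₁⟩ := hx
    refine ⟨F₁, W₁, fun F W hF hW => ?_⟩
    obtain ⟨m₁, a₁⟩ := h₁ F W hF hW
    exact ⟨Submodule.smul_mem _ _ m₁, fun a ha => by
      rw [smul_mul_assoc]; exact Submodule.smul_mem _ _ (a₁ a ha)⟩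

end LeavittPathAlgebra

/-! ### Properness of the involution. -/

namespace LeavittPathAlgebra

variable {K : Type w} [Field K] {E : DirectedGraph.{u, v}}

/-- The linear combinations of paths with range `x`. -/
noncomputable def pathComb (K : Type w) [Field K] {E : DirectedGraph.{u, v}} (x : E.Vertex) :
    ({p : List E.Edge // E.IsPath p x} →₀ K) →ₗ[K] LeavittPathAlgebra K E :=
  Finsupp.linearCombination K fun p => path K p.1 x

theorem pathComb_apply (x : E.Vertex) (l : {p : List E.Edge // E.IsPath p x} →₀ K) :
    pathComb K x l = ∑ p ∈ l.support, l p • path K p.1 x :=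
  Finsupp.linearCombination_apply _ _

theorem pathComb_mul_vert (x : E.Vertex) (l : {p : List E.Edge // E.IsPath p x} →₀ K) :
    pathComb K x l * vert K x = pathComb K x l := by
  rw [pathComb_apply, Finset.sum_mul]
  simp only [smul_mul_assoc, path_mul_vert]

theorem path_mem_range_pathComb (p : List E.Edge) (x : E.Vertex) :
    path K p x ∈ LinearMap.range (pathComb K x) := by
  by_cases h : E.IsPath p x
  · exact ⟨Finsupp.single ⟨p, h⟩ 1, by simp [pathComb]⟩
  · rw [path_eq_zero h]; exact zero_mem _

/-- Orthonormality of the paths: multiplying by `p*` extracts the coefficient of `p`. -/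
theorem gpath_mul_pathComb (hE : E.Acyclic) {x : E.Vertex}
    (l : {p : List E.Edge // E.IsPath p x} →₀ K) (p : {p : List E.Edge // E.IsPath p x}) :
    gpath K p.1 x * pathComb K x l = l p • vert K x := by
  classical
  rw [pathComb_apply, Finset.mul_sum, Finset.sum_eq_single p]
  · rw [mul_smul_comm, gpath_mul_path hE p.2 p.2, if_pos rfl]
  · intro q _ hq
    rw [mul_smul_comm, gpath_mul_path hE p.2 q.2, if_neg (fun h => hq (Subtype.ext h.symm)),
      smul_zero]
  · intro hp
    simp [Finsupp.notMem_support_iff.mp hp]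

theorem star_pathComb_mul_self [StarRing K] (hE : E.Acyclic) {x : E.Vertex}
    (l : {p : List E.Edge // E.IsPath p x} →₀ K) :
    star (pathComb K x l) * pathComb K x l = (∑ p ∈ l.support, star (l p) * l p) • vert K x := by
  conv_lhs => enter [1]; rw [pathComb_apply]
  rw [star_sum, Finset.sum_mul, Finset.sum_smul]
  refine Finset.sum_congr rfl fun p _ => ?_
  rw [star_smul, star_path, smul_mul_assoc, gpath_mul_pathComb hE, smul_smul]

theorem eq_zero_of_sum_star_mul_self [StarRing K] (hK : IsPosDefInvolution K) {ι : Type*}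
    (s : Finset ι) (f : ι → K) (h : ∑ i ∈ s, star (f i) * f i = 0) : ∀ i ∈ s, f i = 0 := by
  -- Positive definiteness concerns families of positive length, so the empty sum is treated apart.
  rcases s.eq_empty_or_nonempty with rfl | hs
  · simp
  intro i hi
  have := hK s.card hs.card_pos (fun j => f (s.equivFin.symm j)) (by
    rw [← h, ← Finset.sum_coe_sort s]
    exact Equiv.sum_comp s.equivFin.symm fun j : s => star (f j) * f j) (s.equivFin ⟨i, hi⟩)
  simpa using this

/-- The involution is proper on linear combinations of paths with a common range. -/
theorem pathComb_proper [StarRing K] (hK : IsPosDefInvolution K) (hE : E.Acyclic) {x : E.Vertex}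
    (l : {p : List E.Edge // E.IsPath p x} →₀ K)
    (h : star (pathComb K x l) * pathComb K x l = 0) : l = 0 := by
  rw [star_pathComb_mul_self hE] at h
  have := eq_zero_of_sum_star_mul_self hK _ _ (smul_vert_eq_zero h)
  ext p
  by_contra hp
  exact hp (this p (Finsupp.mem_support_iff.mpr hp))

/-- Multiplying on the left by `p*` leaves the coefficient of `p` times `e`, and `e` is nonzero
because `e* e` is a vertex. -/
theorem eq_zero_of_pathComb_mul_edge (hE : E.Acyclic) {e : E.Edge}
    (l : {p : List E.Edge // E.IsPath p (E.s e)} →₀ K)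
    (h : pathComb K (E.s e) l * edge K e = 0) : l = 0 := by
  ext p
  refine smul_edge_eq_zero (e := e) ?_
  rw [← source_mul_edge, ← smul_mul_assoc, ← gpath_mul_pathComb hE, mul_assoc, h, mul_zero]

/-- The span of the monomials whose ghost part has length at most `n`. -/
noncomputable def ghostFiltration (K : Type w) [Field K] (E : DirectedGraph.{u, v}) (n : ℕ) :
    Submodule K (LeavittPathAlgebra K E) :=
  Submodule.span K {a | ∃ p x q, q.length ≤ n ∧ a = mono K p x q}

theorem exists_mem_ghostFiltration (a : LeavittPathAlgebra K E) :
    ∃ n, a ∈ ghostFiltration K E n := by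
  obtain ⟨F, W, h⟩ := exists_mem_monoSpan a
  have ha := (h F W subset_rfl subset_rfl).1
  have hmono : Monotone (ghostFiltration K E) := by
    intro m n hmn
    refine Submodule.span_mono ?_
    rintro _ ⟨p, x, q, hq, rfl⟩
    exact ⟨p, x, q, hq.trans hmn, rfl⟩
  refine Submodule.span_induction (p := fun a _ => ∃ n, a ∈ ghostFiltration K E n) ?_ ?_ ?_ ?_ ha
  · rintro _ ⟨p, x, q, -, -, -, -, -, rfl⟩
    exact ⟨q.length, Submodule.subset_span ⟨p, x, q, le_rfl, rfl⟩⟩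
  · exact ⟨0, zero_mem _⟩
  · rintro x y _ _ ⟨m, hm⟩ ⟨n, hn⟩
    exact ⟨max m n, add_mem (hmono (le_max_left m n) hm) (hmono (le_max_right m n) hn)⟩
  · rintro k x _ ⟨m, hm⟩
    exact ⟨m, Submodule.smul_mem _ _ hm⟩

/-- The edge cancels against the last ghost edge or kills the monomial. If there is no ghost edge,
it only extends the real path or gives zero, so the ghost length stays `0`. -/
theorem mul_edge_mem_ghostFiltration {n : ℕ} {a : LeavittPathAlgebra K E}
    (ha : a ∈ ghostFiltration K E (n + 1)) (e : E.Edge) :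
    a * edge K e ∈ ghostFiltration K E n := by
  refine Submodule.span_induction (p := fun a _ => a * edge K e ∈ ghostFiltration K E n)
    ?_ ?_ ?_ ?_ ha
  · rintro _ ⟨p, x, q, hq, rfl⟩
    cases q with
    | nil =>
      have hpe : ∀ p : List E.Edge, path K p (E.s e) * edge K e = path K (p ++ [e]) (E.r e) := by
        intro p
        induction p with
        | nil => simp only [path, List.nil_append, source_mul_edge, edge_mul_range]
        | cons f p ih => rw [path, mul_assoc, ih, List.cons_append, path]
      rw [mono, gpath, path_mul_vert]
      by_cases hx : x = E.s e
      · subst hx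
        rw [hpe]
        refine Submodule.subset_span ⟨p ++ [e], E.r e, [], Nat.zero_le _, ?_⟩
        rw [mono, gpath, path_mul_vert]
      · rw [← source_mul_edge, ← mul_assoc, path_mul_vert_of_ne hx, zero_mul]
        exact zero_mem _
    | cons f q =>
      have : mono K p x (f :: q) * edge K e = mono K p x q * (ghost K f * edge K e) := by
        simp only [mono, gpath, mul_assoc]
      rw [this]
      by_cases hf : f = e
      · subst hf
        rw [ghost_mul_edge_self]
        rcases mono_mul_vert (K := K) (E.r f) p x q with h | h <;> rw [h]
        · exact Submodule.subset_span ⟨p, x, q, Nat.le_of_succ_le_succ hq, rfl⟩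
        · exact zero_mem _
      · rw [ghost_mul_edge_of_ne hf, mul_zero]; exact zero_mem _
  · rw [zero_mul]; exact zero_mem _
  · intro x y _ _ hx hy
    rw [add_mul]; exact add_mem hx hy
  · intro k x _ hx
    rw [smul_mul_assoc]; exact Submodule.smul_mem _ _ hx

theorem mul_vert_mem_range_pathComb {a : LeavittPathAlgebra K E}
    (ha : a ∈ ghostFiltration K E 0) (x : E.Vertex) :
    a * vert K x ∈ LinearMap.range (pathComb K x) := by
  refine Submodule.span_induction (p := fun a _ => a * vert K x ∈ LinearMap.range (pathComb K x))
    ?_ ?_ ?_ ?_ ha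
  · rintro _ ⟨p, y, q, hq, rfl⟩
    rw [List.eq_nil_of_length_eq_zero (Nat.le_zero.mp hq), mono, gpath, path_mul_vert]
    by_cases hx : y = x
    · subst hx
      rw [path_mul_vert]
      exact path_mem_range_pathComb p y
    · rw [path_mul_vert_of_ne hx]; exact zero_mem _
  · rw [zero_mul]; exact zero_mem _
  · intro x y _ _ hx hy
    rw [add_mul]; exact add_mem hx hy
  · intro k x _ hx
    rw [smul_mul_assoc]; exact Submodule.smul_mem _ _ hx

/-- Every element of `L_K(E) x` is a linear combination of paths plus an element of
`∑ L_K(E) e*`, the sum over a finite set of edges `e`. -/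
theorem exists_pathComb_sub (a : LeavittPathAlgebra K E) (x : E.Vertex) :
    ∃ (l : {p : List E.Edge // E.IsPath p x} →₀ K) (F₀ : Finset E.Edge), ∀ F, F₀ ⊆ F →
      (a * vert K x - pathComb K x l) * ∑ e ∈ F, edge K e * ghost K e =
        a * vert K x - pathComb K x l := by
  classical
  -- Lying in `∑ L_K(E) e*` is expressed as being fixed by right multiplication by `∑ e e*`;
  -- demanding it for every larger `F` makes the condition stable under sums.
  obtain ⟨n, ha⟩ := exists_mem_ghostFiltration a
  refine Submodule.span_induction (p := fun a _ =>
    ∃ (l : {p : List E.Edge // E.IsPath p x} →₀ K) (F₀ : Finset E.Edge), ∀ F, F₀ ⊆ F →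
      (a * vert K x - pathComb K x l) * ∑ e ∈ F, edge K e * ghost K e =
        a * vert K x - pathComb K x l) ?_ ?_ ?_ ?_ ha
  · rintro _ ⟨p, y, q, -, rfl⟩
    cases q with
    | nil =>
      obtain ⟨l, hl⟩ : mono K p y [] * vert K x ∈ LinearMap.range (pathComb K x) :=
        mul_vert_mem_range_pathComb (Submodule.subset_span ⟨p, y, [], le_rfl, rfl⟩) x
      exact ⟨l, ∅, fun F _ => by rw [hl, sub_self, zero_mul]⟩
    | cons f q =>
      refine ⟨0, {f}, fun F hF => ?_⟩
      rw [map_zero, sub_zero]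
      rcases mono_mul_vert (K := K) x p y (f :: q) with h | h <;> rw [h]
      · have hm : mono K p y (f :: q) = mono K p y q * ghost K f := by
          rw [mono, mono, gpath, mul_assoc]
        rw [hm, mul_assoc, Finset.mul_sum, Finset.sum_eq_single f]
        · rw [← mul_assoc (ghost K f), ghost_mul_edge_self, range_mul_ghost]
        · intro e _ he
          rw [← mul_assoc, ghost_mul_edge_of_ne he.symm, zero_mul]
        · exact fun hf => absurd (hF (Finset.mem_singleton_self f)) hf
      · rw [zero_mul]
  · exact ⟨0, ∅, fun F _ => by simp⟩
  · rintro a b _ _ ⟨l₁, F₁, h₁⟩ ⟨l₂, F₂, h₂⟩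
    refine ⟨l₁ + l₂, F₁ ∪ F₂, fun F hF => ?_⟩
    have h₁' := h₁ F (Finset.union_subset_left hF)
    have h₂' := h₂ F (Finset.union_subset_right hF)
    rw [map_add, add_mul, add_sub_add_comm, add_mul, h₁', h₂']
  · rintro k a _ ⟨l, F₁, h⟩
    refine ⟨k • l, F₁, fun F hF => ?_⟩
    rw [map_smul, smul_mul_assoc, ← smul_sub, smul_mul_assoc, h F hF]

/-- If `a` annihilates all the edges with source `x`, then `a x` is a linear combination of
paths. -/
theorem mul_vert_mem_range_pathComb_of_forall (hE : E.Acyclic) (a : LeavittPathAlgebra K E)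
    (x : E.Vertex) (h : ∀ e, a * edge K e = 0) :
    a * vert K x ∈ LinearMap.range (pathComb K x) := by
  classical
  obtain ⟨l, F, hF⟩ := exists_pathComb_sub a x
  replace hF := hF F subset_rfl
  have hae : ∀ e, a * vert K x * edge K e = 0 := by
    intro e
    by_cases he : x = E.s e
    · rw [mul_assoc, he, source_mul_edge, h]
    · rw [mul_assoc, vert_mul_edge_of_ne he, mul_zero]
  by_cases hne : {e : E.Edge | E.s e = x}.Nonempty
  · have : a * vert K x = 0 := by
      by_cases hx : ∀ e, E.s e = x → e ∈ F
      · have hfin : {e : E.Edge | E.s e = x}.Finite := F.finite_toSet.subset hx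
        rw [vert_eq_sum x hfin hne, Finset.mul_sum]
        exact Finset.sum_eq_zero fun e _ => by rw [← mul_assoc, h, zero_mul]
      · push Not at hx
        obtain ⟨e, rfl, he⟩ := hx
        -- As `e ∉ F`, right multiplication by `e` kills the remainder `a * x - l`, where `l`
        -- denotes the path combination. It also kills `a * x`, hence `l`, and so `l = 0`. Then `a *
        -- x` is its own remainder, a sum of terms `(a * x * f) * f*`, all zero.
        have h1 := congrArg (· * edge K e) hF
        have h2 : (∑ f ∈ F, edge K f * ghost K f) * edge K e = 0 := by
          rw [Finset.sum_mul]
          refine Finset.sum_eq_zero fun f hf => ?_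
          rw [mul_assoc, ghost_mul_edge_of_ne (by rintro rfl; exact he hf), mul_zero]
        simp only [mul_assoc _ _ (edge K e), h2, mul_zero] at h1
        rw [sub_mul, hae, zero_sub, eq_comm, neg_eq_zero] at h1
        have hl := eq_zero_of_pathComb_mul_edge hE l h1
        rw [hl, map_zero, sub_zero, Finset.mul_sum] at hF
        rw [← hF]
        exact Finset.sum_eq_zero fun f _ => by rw [← mul_assoc, hae, zero_mul]
    rw [this]
    exact zero_mem _
  -- Here `x` is a sink, so every edge kills the path combination as well as `a * x`. The remainder
  -- is thus zero.
  · refine ⟨l, (sub_eq_zero.mp ?_).symm⟩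
    rw [← hF, Finset.mul_sum]
    refine Finset.sum_eq_zero fun f _ => ?_
    have hf : x ≠ E.s f := fun hf => hne ⟨f, hf.symm⟩
    rw [← mul_assoc, sub_mul, hae, ← pathComb_mul_vert, mul_assoc, vert_mul_edge_of_ne hf,
      mul_zero, sub_zero, zero_mul]

/-- Over a field with positive definite involution, the involution of the Leavitt path algebra
of an acyclic graph is proper. -/
theorem proper_of_isPosDefInvolution [StarRing K] (hK : IsPosDefInvolution K) (hE : E.Acyclic)
    (a : LeavittPathAlgebra K E) (ha : star a * a = 0) : a = 0 := by
  have hmul : ∀ a b : LeavittPathAlgebra K E, star a * a = 0 → star (a * b) * (a * b) = 0 := by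
    intro a b h
    rw [star_mul, mul_assoc, ← mul_assoc (star a), h, zero_mul, mul_zero]
  have hreal : ∀ a : LeavittPathAlgebra K E, star a * a = 0 →
      (∀ x, a * vert K x ∈ LinearMap.range (pathComb K x)) → a = 0 := by
    intro a h hx
    refine eq_zero_of_forall_mul_vert a fun x => ?_
    obtain ⟨l, hl⟩ := hx x
    have := hmul a (vert K x) h
    rw [← hl] at this
    rw [← hl, pathComb_proper hK hE l this, map_zero]
  obtain ⟨n, hn⟩ := exists_mem_ghostFiltration a
  induction n generalizing a with
  | zero => exact hreal a ha (mul_vert_mem_range_pathComb hn)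
  | succ n ih =>
    -- Each `a * e` inherits `star (a * e) * (a * e) = 0` and has shorter ghost parts, so it
    -- vanishes by induction.
    refine hreal a ha fun x => mul_vert_mem_range_pathComb_of_forall hE a x fun e => ?_
    exact ih _ (hmul a _ ha) (mul_edge_mem_ghostFiltration hn e)

theorem isStarRegular_of_isPosDefInvolution [StarRing K] (hK : IsPosDefInvolution K)
    (hE : E.Acyclic) : IsStarRegular (LeavittPathAlgebra K E) := by
  refine isStarRegular_of_locallyFinite (K := K) (proper_of_isPosDefInvolution hK hE) fun h => ?_
  obtain ⟨F, W, hFW⟩ := exists_mem_monoSpan h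
  obtain ⟨h1, h2⟩ := hFW F W subset_rfl subset_rfl
  exact ⟨_, finiteDimensional_monoSpan hE F W, h1, h2⟩

end LeavittPathAlgebra

/-! ### Fan graphs and the converse. -/

/-- The graph with `n` edges from `n` distinct vertices to one sink. -/
def fanGraph (n : ℕ) : DirectedGraph.{u, v} where
  Vertex := ULift (Option (Fin n))
  Edge := ULift (Fin n)
  s e := ⟨some e.down⟩
  r _ := ⟨none⟩

theorem fanGraph_acyclic (n : ℕ) : (fanGraph.{u, v} n).Acyclic := by
  rintro p ⟨-, ⟨_, h⟩, -⟩
  simp [fanGraph] at h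

open LeavittPathAlgebra in
-- For `a = ∑ xᵢ eᵢ`, orthogonality of the edges gives `star a * a = (∑ star xᵢ * xᵢ) • o`, with `o`
-- the sink, and `eᵢ* a = xᵢ • o` recovers the coefficients once `a = 0`.
theorem isNProper_of_isStarRegular_fanGraph {K : Type w} [Field K] [StarRing K] {n : ℕ}
    (h : IsStarRegular (LeavittPathAlgebra K (fanGraph.{u, v} n))) : IsNProper K n := by
  intro x hx i
  let o : (fanGraph.{u, v} n).Vertex := ULift.up none
  let ε : Fin n → (fanGraph.{u, v} n).Edge := ULift.up
  have hε : ∀ i j, ghost K (ε i) * edge K (ε j) = if i = j then vert K o else 0 := by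
    intro i j
    split_ifs with hij
    · subst hij; exact ghost_mul_edge_self _
    · exact ghost_mul_edge_of_ne fun hh => hij (congrArg ULift.down hh)
  obtain ⟨a, ha⟩ : ∃ a, a = ∑ i, x i • edge K (ε i) := ⟨_, rfl⟩
  have hga : ∀ i, ghost K (ε i) * a = x i • vert K o := by
    intro i
    simp [ha, Finset.mul_sum, mul_smul_comm, hε]
  have haa : star a * a = 0 := by
    have hs : star a = ∑ i, star (x i) • ghost K (ε i) := by
      rw [ha, star_sum]
      exact Finset.sum_congr rfl fun i _ => by rw [star_smul]; exact congrArg _ (star_gen _)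
    rw [hs, Finset.sum_mul]
    simp only [smul_mul_assoc, hga, smul_smul, ← Finset.sum_smul, hx, zero_smul]
  have hav : a * vert K o = a := by
    rw [ha, Finset.sum_mul]
    exact Finset.sum_congr rfl fun i _ => by
      rw [smul_mul_assoc]; exact congrArg _ (edge_mul_range (ε i))
  obtain ⟨p, hp, hap⟩ := h a
  -- The sink is a right unit for `a`, which puts `a` in its own right ideal without an identity
  -- element.
  obtain ⟨y, hy⟩ : a ∈ Set.range (p * ·) := hap ▸ ⟨_, hav⟩
  obtain ⟨z, hz⟩ : p ∈ Set.range (a * ·) := hap ▸ ⟨p, hp.isIdempotentElem⟩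
  have hpa : p * a = a := by
    simp only at hy
    rw [← hy, ← mul_assoc, hp.isIdempotentElem.eq]
  -- From `p = a * z` and `star p = p` follows `a = p * a = star z * (star a * a) = 0`.
  have ha0 : a = 0 := by
    simp only at hz
    rw [← hpa, ← hp.isSelfAdjoint.star_eq, ← hz, star_mul, mul_assoc, haa, mul_zero]
  refine smul_vert_eq_zero (x := o) ?_
  rw [← hga i, ha0, mul_zero]

theorem corollary3p4 (K : Type w) [Field K] [StarRing K] :
    IsPosDefInvolution K ↔
      ∀ E : DirectedGraph.{u, v}, E.Acyclic → IsStarRegular (LeavittPathAlgebra K E) :=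
  ⟨fun hK _ hE => LeavittPathAlgebra.isStarRegular_of_isPosDefInvolution hK hE,
    fun h n _ => isNProper_of_isStarRegular_fanGraph (h _ (fanGraph_acyclic n))⟩
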